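/- For an integer $n\ge 0$ let $\Pi_n(\mathbb S^2)$ be the space of restrictions to the unit sphere $\mathbb S^2\subset\mathbb R^3$ of real polynomials in three variables of total degree at most $n$. For $s\in\mathbb N$ and $\alpha\in\{0,1\}$ let $$\Theta_{\alpha,s}=\Big\{\tfrac{(2j+\alpha)\pi}{2s}: j=0,1,\dots,2s-1\Big\}.$$ Let $n$ be an odd natural number and let $\lambda_1,\dots,\lambda_\sigma$ $(\sigma\in\mathbb N)$ be positive integers with $$\lambda_1+\dots+\lambda_\sigma=\frac{n+1}{2}.$$ Define $n_0=n$ and $n_k=n_{k-1}-2\lambda_k$ for $1\le k\le\sigma-1$. Let $\theta_{i,k}$, $1\le i\le 2\lambda_k$, $1\le k\le\sigma$, be pairwise distinct numbers in $(0,\pi)$ with $$\theta_{2\lambda_k+1-i,k}=\pi-\theta_{i,k}\qquad(1\le i\le\lambda_k,\ 1\le k\le\sigma),$$ and suppose that for each $k$ the angles $\theta_{1,k},\dots,\theta_{\lambda_k,k}$ belong to the same open hemisphere, that is, they all lie in $(0,\pi/2)$ or they all lie in $(\pi/2,\pi)$. Let $X\subset\mathbb S^2$ be the set of all points $$(\sin\theta_{i,k}\cos\phi,\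 \sin\theta_{i,k}\sin\phi,\ \cos\theta_{i,k}),\qquad 1\le k\le\sigma,\ 1\le i\le2\lambda_k,$$ where $\phi$ runs through $\Theta_{0,\,n_{k-1}-\lambda_k+1}$ if $1\le i\le\lambda_k$, and through $\Theta_{1,\,n_{k-1}-\lambda_k+1}$ if $\lambda_k+1\le i\le2\lambda_k$. Then $X$ solves the interpolation problem in $\Pi_n(\mathbb S^2)$: $X$ consists of exactly $(n+1)^2$ points, and for every choice of real data $(f_a)_{a\in X}$ there is exactly one $T\in\Pi_n(\mathbb S^2)$ with $T(a)=f_a$ for all $a\in X$. -/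

import Mathlib

open scoped Real

noncomputable section

namespace SphereInterpolation

/-- The unit sphere `S²` of Euclidean `ℝ³`. -/
abbrev S2 : Type := Metric.sphere (0 : EuclideanSpace ℝ (Fin 3)) 1

/-- Restriction of a real polynomial in three variables to a function on `S²`. -/
def restrictToSphere : MvPolynomial (Fin 3) ℝ →ₗ[ℝ] (S2 → ℝ) :=
  LinearMap.pi fun x : S2 =>
    (MvPolynomial.aeval (R := ℝ) fun i : Fin 3 => (x : EuclideanSpace ℝ (Fin 3)) i).toLinearMap

/-- The space `Π_n(S²)` of spherical polynomials of degree at most `n`. -/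
def sphericalPolys (n : ℕ) : Submodule ℝ (S2 → ℝ) :=
  (MvPolynomial.restrictTotalDegree (Fin 3) ℝ n).map restrictToSphere

/-- A set `X` of points of `S²` solves the interpolation problem in `Π_n(S²)` (is poised):
it consists of exactly `(n+1)²` points, and arbitrary data on `X` are interpolated by exactly one
spherical polynomial of degree at most `n`. -/
def SolvesInterpolation (n : ℕ) (X : Set S2) : Prop :=
  X.ncard = (n + 1) ^ 2 ∧
    ∀ f : X → ℝ, ∃! T : S2 → ℝ, T ∈ sphericalPolys n ∧ ∀ x : X, T x = f x

/-- The point of `S²` with spherical coordinates `(θ, φ)`, where `θ` is the angle to the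
`z`-axis. -/
def sphericalPoint (θ φ : ℝ) : S2 :=
  ⟨!₂[Real.sin θ * Real.cos φ, Real.sin θ * Real.sin φ, Real.cos θ], by
    have h1 := Real.sin_sq_add_cos_sq θ
    have h2 := Real.sin_sq_add_cos_sq φ
    rw [mem_sphere_zero_iff_norm, EuclideanSpace.norm_eq, Real.sqrt_eq_one]
    simp [Fin.sum_univ_three]
    linear_combination h1 + (Real.sin θ) ^ 2 * h2⟩

/-- The `2s` equidistant angles `(2j+α)π/(2s)`, `j = 0, …, 2s-1`. -/
def Theta (α : ℝ) (s : ℕ) : Set ℝ :=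
  {φ | ∃ j < 2 * s, φ = (2 * (j : ℝ) + α) * π / (2 * (s : ℝ))}

/-- The degrees `n_0 = n`, `n_k = n_{k-1} - 2 λ_k`. If `λ_1, …, λ_σ` are positive and
`λ_1 + ⋯ + λ_σ = (n+1)/2`, with `n` odd, then the subtraction is exact for `k ≤ σ - 1`, and only
these `n_k` are used. -/
def degrees (n : ℕ) (lam : ℕ → ℕ) : ℕ → ℕ
  | 0 => n
  | k + 1 => degrees n lam k - 2 * lam (k + 1)

/-- The number `n_{k-1} - λ_k + 1`: each latitude of the `k`-th group (`k ≥ 1`) carries twice as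
many points. -/
def halfCount (n : ℕ) (lam : ℕ → ℕ) (k : ℕ) : ℕ :=
  degrees n lam (k - 1) + 1 - lam k

/-- The nodes: for `1 ≤ k ≤ σ` and `1 ≤ i ≤ 2 λ_k`, the latitude at polar angle `θ i k` carries the
points whose azimuth runs over `Theta 0 (n_{k-1} - λ_k + 1)` if `i ≤ λ_k`, and over
`Theta 1 (n_{k-1} - λ_k + 1)` if `i ≥ λ_k + 1`. -/
def nodes (n σ : ℕ) (lam : ℕ → ℕ) (θ : ℕ → ℕ → ℝ) : Set S2 :=
  {x | ∃ k ∈ Finset.Icc 1 σ, ∃ i ∈ Finset.Icc 1 (2 * lam k),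
    ∃ φ ∈ Theta (if i ≤ lam k then 0 else 1) (halfCount n lam k), x = sphericalPoint (θ i k) φ}

end SphereInterpolation

end

/-! Since `(n+1)² ≤ dim Π_n` (`sq_le_finrank_sphericalPolys`) and there are at most `(n+1)²` nodes,
it is enough that only `T = 0` vanishes on them; bijectivity of evaluation and the exact number of
nodes then follow.

Write `T = ∑ sin^{|m|} θ p_m(cos θ) e^{imφ}` with `deg p_m < N - |m|`, where `N = n_{k-1} + 1`, and
take the `k`-th group with `l = λ_k`, `s = N - l`. Vanishing at `2s` equidistant azimuths couples
only the frequencies `μ` and `μ - 2s` (`coeff_add_aliased_eq_zero`). If `|m| ≤ s - l`, the partner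
of `m` is out of range, so `p_m` vanishes at all `2l` cosines of the group and is divisible by their
nodal polynomial. The other coefficients come in pairs `P, Q` with `deg P < l + r`, `deg Q < l - r`,
satisfying `P + (1-c²)^r Q = 0` on a set `Z` and `P - (1-c²)^r Q = 0` on `-Z`; such pairs vanish
(`pair_eq_zero`). Hence the nodal polynomial divides `T`, the quotient has `N - 2l` in place of `N`,
and it still vanishes on the later groups. After the last group the bound is `0`, so `T = 0`.

The analytic core is `pair_eq_zero`: an elimination turns the pair into a nonnegative rational
function with zero integral over the line. It needs `Z` on one side of the origin, which is the
hemisphere condition. -/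

noncomputable section

namespace SphereInterpolation

/-! ### Unisolvence for a pair of coupled polynomials -/

section ChebyshevSystem
open Polynomial Filter Topology

lemma degree_mul_lt {R : Type*} [Semiring R] {p q : R[X]} {a b c : ℕ} (hp : p.degree < a)
    (hq : q.degree < b) (h : a + b ≤ c + 1) : (p * q).degree < c := by
  by_cases hp0 : p = 0
  · simp [hp0]
  by_cases hq0 : q = 0
  · simp [hq0]
  refine (degree_mul_le p q).trans_lt ?_
  rw [degree_eq_natDegree hp0] at hp ⊢
  rw [degree_eq_natDegree hq0] at hq ⊢
  norm_cast at *
  omega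

lemma degree_lt_of_le {R : Type*} [Semiring R] {p : R[X]} {a b : ℕ} (hp : p.degree < a)
    (h : a ≤ b) : p.degree < b :=
  hp.trans_le (by exact_mod_cast h)

/-- A polynomial is the sum of its even and odd parts. -/
lemma exists_even_odd (d : ℕ) : ∀ P : ℝ[X], P.degree < d → ∃ E O : ℝ[X],
    P = E.comp (X ^ 2) + X * O.comp (X ^ 2) ∧ E.degree < ((d + 1) / 2 : ℕ) ∧
      O.degree < (d / 2 : ℕ) := by
  induction d with
  | zero =>
    intro P hP
    have : P = 0 := by simpa [Nat.WithBot.lt_zero_iff] using hP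
    exact ⟨0, 0, by simp [this], by simp, by simp⟩
  | succ d ih =>
    intro P hP
    have hdiv : P.divX.degree < d := by
      by_cases h0 : P = 0
      · simp [h0]
      · have h1 := degree_divX_lt h0
        rw [degree_eq_natDegree h0] at hP h1
        refine h1.trans_le ?_
        norm_cast at *
        omega
    obtain ⟨E, O, h, hE, hO⟩ := ih _ hdiv
    -- Multiplication by `X` exchanges parity: `P = c + X * P.divX`, so the odd part of `P.divX`
    -- feeds the even part of `P` and conversely.
    refine ⟨C (P.coeff 0) + X * O, E, ?_, ?_, hE⟩
    · conv_lhs => rw [← divX_mul_X_add P, h]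
      simp only [add_comp, mul_comp, X_comp, C_comp]
      ring
    · refine (degree_add_le _ _).trans_lt (max_lt ?_ ?_)
      · refine degree_C_le.trans_lt ?_
        exact_mod_cast (by omega : 0 < (d + 1 + 1) / 2)
      · have hX : (X : ℝ[X]).degree < (2 : ℕ) := by rw [degree_X]; norm_num
        exact degree_mul_lt hX hO (by omega)

/-- Partial fractions with poles on the negative axis, whose sum has a fixed sign on the
imaginary axis and zero integral, vanish. -/
lemma sum_div_add_sq_eq_zero (Y : Finset ℝ) (hY : ∀ y ∈ Y, 0 < y) (κ : ℝ → ℝ)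
    (hκ : ∑ y ∈ Y, κ y / √y = 0) (hnn : ∀ t : ℝ, 0 ≤ ∑ y ∈ Y, κ y / (y + t ^ 2)) (t : ℝ) :
    ∑ y ∈ Y, κ y / (y + t ^ 2) = 0 := by
  -- An explicit antiderivative replaces the integral: it is monotone and tends to `∓(π/2) ∑ κ y /
  -- √y = 0` at both ends, hence is constant.
  set Φ : ℝ → ℝ := fun t => ∑ y ∈ Y, κ y / √y * Real.arctan (t / √y) with hΦ
  have hder : ∀ t, HasDerivAt Φ (∑ y ∈ Y, κ y / (y + t ^ 2)) t := by
    intro t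
    refine HasDerivAt.fun_sum fun y hy => ?_
    have hs : 0 < √y := Real.sqrt_pos.2 (hY y hy)
    have h1 := (((hasDerivAt_id t).div_const (√y)).arctan).const_mul (κ y / √y)
    refine h1.congr_deriv ?_
    have h2 : √y ^ 2 = y := Real.sq_sqrt (hY y hy).le
    have h3 : y + t ^ 2 ≠ 0 := by have := hY y hy; positivity
    have h4 : 1 + (t / √y) ^ 2 = (y + t ^ 2) / y := by
      rw [div_pow, h2]; field_simp [(hY y hy).ne']
    have hy0 := (hY y hy).ne'
    simp only [id]
    rw [h4]
    field_simp
    rw [h2]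
  have hmono : Monotone Φ := by
    refine monotone_of_deriv_nonneg (fun t => (hder t).differentiableAt) fun t => ?_
    rw [(hder t).deriv]
    exact hnn t
  have htop : Tendsto Φ atTop (𝓝 0) := by
    have : Tendsto Φ atTop (𝓝 (∑ y ∈ Y, κ y / √y * (π / 2))) := by
      refine tendsto_finsetSum _ fun y hy => Tendsto.const_mul _ ?_
      exact (tendsto_nhds_of_tendsto_nhdsWithin Real.tendsto_arctan_atTop).comp
        (tendsto_id.atTop_div_const (Real.sqrt_pos.2 (hY y hy)))
    rwa [← Finset.sum_mul, hκ, zero_mul] at this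
  have hbot : Tendsto Φ atBot (𝓝 0) := by
    have : Tendsto Φ atBot (𝓝 (∑ y ∈ Y, κ y / √y * (-(π / 2)))) := by
      refine tendsto_finsetSum _ fun y hy => Tendsto.const_mul _ ?_
      exact (tendsto_nhds_of_tendsto_nhdsWithin Real.tendsto_arctan_atBot).comp
        (tendsto_id.atBot_div_const (Real.sqrt_pos.2 (hY y hy)))
    rwa [← Finset.sum_mul, hκ, zero_mul] at this
  have hzero : Φ = fun _ => 0 := by
    funext t
    exact le_antisymm (hmono.ge_of_tendsto htop t) (hmono.le_of_tendsto hbot t)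
  have h1 := hder t
  rw [hzero] at h1
  exact h1.unique (hasDerivAt_const t 0)

/-- The divided difference of `A` over `Y` is zero by degree, and `A = -h / √y` at the nodes. This
is exactly the statement that the partial fractions of `h(-t²) / ∏ (y + t²)` have zero integral; as
the function is nonnegative, it vanishes. -/
lemma eval_neg_sq_eq_zero (Y : Finset ℝ) (hY : ∀ y ∈ Y, 0 < y) (A h : ℝ[X])
    (hA : A.degree < (Y.card - 1 : ℕ)) (hh : h.degree < Y.card)
    (hnodes : ∀ y ∈ Y, A.eval y * √y + h.eval y = 0)
    (hnn : ∀ t : ℝ, 0 ≤ h.eval (-t ^ 2)) (t : ℝ) : h.eval (-t ^ 2) = 0 := by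
  have hinj : Set.InjOn (id : ℝ → ℝ) Y := Function.injective_id.injOn
  have hsumA : ∑ y ∈ Y, Lagrange.nodalWeight Y id y * A.eval y = 0 := by
    have h1 := Lagrange.coeff_eq_sum hinj (degree_lt_of_le hA (Nat.sub_le _ _))
    rw [coeff_eq_zero_of_degree_lt hA] at h1
    rw [h1]
    refine Finset.sum_congr rfl fun y _ => ?_
    rw [Lagrange.nodalWeight, Finset.prod_inv_distrib, div_eq_mul_inv, mul_comm]
    rfl
  have hprod : ∀ t : ℝ, 0 < ∏ y ∈ Y, (y + t ^ 2) := fun t =>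
    Finset.prod_pos fun y hy => by have := hY y hy; positivity
  -- Lagrange interpolation of `h` on `Y`, evaluated at `-t²`, is the partial fraction expansion.
  have hpf : ∀ t : ℝ, h.eval (-t ^ 2) = (∏ y ∈ Y, (y + t ^ 2)) *
      ∑ y ∈ Y, ((-1) ^ (Y.card + 1) * (Lagrange.nodalWeight Y id y * h.eval y)) / (y + t ^ 2) := by
    intro t
    have hx : ∀ y ∈ Y, -t ^ 2 ≠ id y := by
      intro y hy h0
      have := hY y hy
      simp only [id] at h0
      nlinarith [sq_nonneg t]
    have h1 := Lagrange.eval_interpolate_not_at_node (fun y => h.eval (id y)) hx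
    rw [← Lagrange.eq_interpolate hinj hh, Lagrange.eval_nodal] at h1
    rw [h1]
    have h2 : ∏ y ∈ Y, (-t ^ 2 - id y) = (-1) ^ Y.card * ∏ y ∈ Y, (y + t ^ 2) := by
      rw [← Finset.prod_const, ← Finset.prod_mul_distrib]
      exact Finset.prod_congr rfl fun y _ => by simp only [id]; ring
    rw [h2, mul_comm _ (∏ y ∈ Y, (y + t ^ 2)), mul_assoc, Finset.mul_sum]
    congr 1
    refine Finset.sum_congr rfl fun y hy => ?_
    have h3 : -t ^ 2 - id y = -(y + t ^ 2) := by simp only [id]; ring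
    rw [h3, inv_neg, div_eq_mul_inv, pow_succ]
    simp only [id]
    ring
  have hz := sum_div_add_sq_eq_zero Y hY
    (fun y => (-1) ^ (Y.card + 1) * (Lagrange.nodalWeight Y id y * h.eval y)) ?_ ?_ t
  · rw [hpf, hz, mul_zero]
  · have h4 : ∀ y ∈ Y, (-1) ^ (Y.card + 1) * (Lagrange.nodalWeight Y id y * h.eval y) / √y =
        (-1) ^ Y.card * (Lagrange.nodalWeight Y id y * A.eval y) := by
      intro y hy
      have hs : 0 < √y := Real.sqrt_pos.2 (hY y hy)
      have h5 : h.eval y = -(A.eval y * √y) := by linarith [hnodes y hy]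
      rw [h5, pow_succ]
      field_simp
    rw [Finset.sum_congr rfl h4, ← Finset.mul_sum, hsumA, mul_zero]
  · intro t
    have h5 := hnn t
    rw [hpf] at h5
    exact nonneg_of_mul_nonneg_right h5 (hprod t)

lemma eq_zero_of_eval_neg_sq {p : ℝ[X]} (h : ∀ t : ℝ, t ≠ 0 → p.eval (-t ^ 2) = 0) : p = 0 := by
  refine p.eq_zero_of_infinite_isRoot (Set.Infinite.mono ?_ (Set.Iio_infinite (0 : ℝ)))
  intro x hx
  have hx' : 0 < -x := neg_pos.2 hx
  have := h (√(-x)) (Real.sqrt_pos.2 hx').ne'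
  rwa [Real.sq_sqrt hx'.le, neg_neg] at this

/-- With `P = E(c²) + c O(c²)`, `Q = E'(c²) + c O'(c²)` and `y = c²`, eliminating between the
equations at `c` and `-c` gives `√y (O E' - E O') + h = 0`, where `h = (1-y)^r (E'² - y O'²)`. At `y
= -t²` the factor `E'² + t² O'²` is a sum of squares, so vanishing of `h` there kills `Q`; then `P`
has `2|Z|` roots and degree below `|Z| + r`. -/
lemma pair_eq_zero_of_pos (Z : Finset ℝ) (hZ : ∀ c ∈ Z, 0 < c) (r : ℕ) (hr : r < Z.card)
    (P Q : ℝ[X]) (hP : P.degree < (Z.card + r : ℕ)) (hQ : Q.degree < (Z.card - r : ℕ))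
    (h1 : ∀ c ∈ Z, P.eval c + (1 - c ^ 2) ^ r * Q.eval c = 0)
    (h2 : ∀ c ∈ Z, P.eval (-c) - (1 - c ^ 2) ^ r * Q.eval (-c) = 0) : P = 0 ∧ Q = 0 := by
  classical
  obtain ⟨E, O, hPeq, hE, hO⟩ := exists_even_odd _ P hP
  obtain ⟨E', O', hQeq, hE', hO'⟩ := exists_even_odd _ Q hQ
  set Y : Finset ℝ := Z.image (fun c => c ^ 2) with hYdef
  have hcard : Y.card = Z.card := by
    refine Finset.card_image_of_injOn fun a ha b hb hab => ?_
    exact (sq_eq_sq₀ (hZ a ha).le (hZ b hb).le).1 hab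
  have hYpos : ∀ y ∈ Y, 0 < y := by
    intro y hy
    obtain ⟨c, hc, rfl⟩ := Finset.mem_image.1 hy
    exact pow_pos (hZ c hc) 2
  set h : ℝ[X] := (1 - X) ^ r * (E' * E' - X * (O' * O')) with hh
  have hX : (X : ℝ[X]).degree < (2 : ℕ) := by rw [degree_X]; norm_num
  have hval : ∀ t : ℝ, h.eval (-t ^ 2) =
      (1 + t ^ 2) ^ r * (E'.eval (-t ^ 2) ^ 2 + t ^ 2 * O'.eval (-t ^ 2) ^ 2) := by
    intro t
    simp only [hh, eval_mul, eval_pow, eval_sub, eval_one, eval_X]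
    ring
  have key := eval_neg_sq_eq_zero Y hYpos (O * E' - E * O') h ?_ ?_ ?_ ?_
  · have hz : ∀ t : ℝ, E'.eval (-t ^ 2) ^ 2 + t ^ 2 * O'.eval (-t ^ 2) ^ 2 = 0 := by
      intro t
      have := key t
      rw [hval] at this
      have hp : (1 + t ^ 2) ^ r ≠ 0 := by positivity
      exact (mul_eq_zero.1 this).resolve_left hp
    have hE0 : E' = 0 := eq_zero_of_eval_neg_sq fun t _ => by
      have := hz t
      have h3 : 0 ≤ t ^ 2 * O'.eval (-t ^ 2) ^ 2 := by positivity
      exact pow_eq_zero_iff (two_ne_zero) |>.1 (by nlinarith [sq_nonneg (E'.eval (-t ^ 2))])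
    have hO0 : O' = 0 := eq_zero_of_eval_neg_sq fun t ht => by
      have := hz t
      rw [hE0, eval_zero] at this
      have h3 : t ^ 2 * O'.eval (-t ^ 2) ^ 2 = 0 := by linarith
      exact pow_eq_zero_iff (two_ne_zero) |>.1
        ((mul_eq_zero.1 h3).resolve_left (pow_ne_zero 2 ht))
    have hQ0 : Q = 0 := by rw [hQeq, hE0, hO0]; simp
    refine ⟨?_, hQ0⟩
    rw [hQ0] at h1 h2
    refine eq_zero_of_degree_lt_of_eval_finset_eq_zero (Z ∪ Z.image (fun c => -c)) ?_ ?_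
    · have hdisj : Disjoint Z (Z.image (fun c => -c)) := by
        rw [Finset.disjoint_left]
        intro a ha hb
        obtain ⟨b, hb, hab⟩ := Finset.mem_image.1 hb
        have := hZ a ha
        have := hZ b hb
        linarith
      rw [Finset.card_union_of_disjoint hdisj, Finset.card_image_of_injective _ neg_injective]
      exact degree_lt_of_le hP (by omega)
    · intro x hx
      rcases Finset.mem_union.1 hx with hx | hx
      · simpa using h1 x hx
      · obtain ⟨c, hc, rfl⟩ := Finset.mem_image.1 hx
        simpa using h2 c hc
  · rw [hcard]
    refine (degree_sub_le _ _).trans_lt (max_lt ?_ ?_)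
    · exact degree_mul_lt hO hE' (by omega)
    · exact degree_mul_lt hE hO' (by omega)
  · rw [hcard]
    have hpow : ((1 - X : ℝ[X]) ^ r).degree < (r + 1 : ℕ) := by
      refine (degree_pow_le _ _).trans_lt ?_
      have : (1 - X : ℝ[X]).degree ≤ 1 := by
        refine (degree_sub_le _ _).trans (max_le ?_ degree_X_le)
        exact degree_one_le.trans (by norm_num)
      refine (nsmul_le_nsmul_right this r).trans_lt ?_
      rw [nsmul_one]
      exact_mod_cast Nat.lt_succ_self r
    refine degree_mul_lt (b := Z.card - r) hpow ?_ (by omega)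
    refine (degree_sub_le _ _).trans_lt (max_lt ?_ ?_)
    · exact degree_mul_lt hE' hE' (by omega)
    -- With `b = (|Z| - r) / 2`, the square of `O'` has degree below `2b - 1`; the cruder bound `2b`
    -- would be one too large after multiplication by `X`.
    · exact degree_mul_lt hX (degree_mul_lt (c := 2 * ((Z.card - r) / 2) - 1) hO' hO' (by omega))
        (by omega)
  · intro y hy
    obtain ⟨c, hc, rfl⟩ := Finset.mem_image.1 hy
    have hc0 := hZ c hc
    have e1 := h1 c hc
    have e2 := h2 c hc
    rw [hPeq, hQeq] at e1 e2
    simp only [eval_add, eval_mul, eval_X, eval_comp, eval_pow, neg_sq] at e1 e2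
    simp only [hh, eval_mul, eval_pow, eval_sub, eval_one, eval_X]
    rw [Real.sqrt_sq hc0.le]
    set e := E.eval (c ^ 2)
    set o := O.eval (c ^ 2)
    set e' := E'.eval (c ^ 2)
    set o' := O'.eval (c ^ 2)
    set w := (1 - c ^ 2) ^ r
    -- The weights make the `Q`-terms add up to `w (e' + c o') (e' - c o')`.
    linear_combination (e' - c * o') / 2 * e1 - (e' + c * o') / 2 * e2
  · intro t
    rw [hval]
    positivity

/-- A pair of polynomials coupled on `Z` and on `-Z` with opposite signs vanishes, as long as `Z`
lies on one side of the origin. -/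
lemma pair_eq_zero (Z : Finset ℝ) (hZ : (∀ c ∈ Z, 0 < c) ∨ (∀ c ∈ Z, c < 0)) (r : ℕ)
    (hr : r < Z.card) (P Q : ℝ[X]) (hP : P.degree < (Z.card + r : ℕ))
    (hQ : Q.degree < (Z.card - r : ℕ))
    (h1 : ∀ c ∈ Z, P.eval c + (1 - c ^ 2) ^ r * Q.eval c = 0)
    (h2 : ∀ c ∈ Z, P.eval (-c) - (1 - c ^ 2) ^ r * Q.eval (-c) = 0) : P = 0 ∧ Q = 0 := by
  classical
  rcases hZ with hZ | hZ
  · exact pair_eq_zero_of_pos Z hZ r hr P Q hP hQ h1 h2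
  · have hcard : (Z.image (fun c => -c)).card = Z.card :=
      Finset.card_image_of_injective _ neg_injective
    have := pair_eq_zero_of_pos (Z.image (fun c => -c)) ?_ r (by rwa [hcard]) P (-Q)
      (by rwa [hcard]) (by rwa [hcard, degree_neg]) ?_ ?_
    · exact ⟨this.1, neg_eq_zero.1 this.2⟩
    all_goals
      intro c hc
      obtain ⟨d, hd, rfl⟩ := Finset.mem_image.1 hc
    · exact neg_pos.2 (hZ d hd)
    · have := h2 d hd
      rw [eval_neg, neg_sq]
      linarith
    · have := h1 d hd
      rw [eval_neg, neg_sq, neg_neg]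
      linarith

end ChebyshevSystem

/-! ### Discrete Fourier orthogonality on equidistant azimuths -/

section Aliasing
open Complex

/-- A trigonometric sum with frequencies `|m| < 2s` that vanishes at `2s` equidistant angles
only couples the frequencies `μ` and `μ - 2s`. -/
lemma coeff_add_aliased_eq_zero {s : ℕ} (hs : 0 < s) (α : ℝ) (ε : ℂ)
    (hε : exp (-(α * π * I)) = ε) (S : Finset ℤ) (c : ℤ → ℂ)
    (hS : ∀ m, m ∉ S → c m = 0) (hc : ∀ m : ℤ, 2 * s ≤ m.natAbs → c m = 0)
    (hvan : ∀ j < 2 * s, ∑ m ∈ S, c m *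
      exp (m * (((2 * (j : ℝ) + α) * π / (2 * (s : ℝ)) : ℝ) : ℂ) * I) = 0)
    (μ : ℤ) (hμ0 : 0 ≤ μ) (hμ : μ < 2 * s) : c μ + ε * c (μ - 2 * s) = 0 := by
  have hs0 : (s : ℂ) ≠ 0 := by exact_mod_cast hs.ne'
  set ζ : ℂ := exp (2 * π * I / ((2 * s : ℕ) : ℂ)) with hζ
  have hprim : IsPrimitiveRoot ζ (2 * s) := isPrimitiveRoot_exp _ (by omega)
  set d : ℤ → ℂ := fun m => c m * exp (m * (α * π / (2 * s)) * I) with hd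
  have hexp : ∀ (m : ℤ) (j : ℕ),
      c m * exp (m * (((2 * (j : ℝ) + α) * π / (2 * (s : ℝ)) : ℝ) : ℂ) * I) =
        d m * (ζ ^ m) ^ j := by
    intro m j
    rw [hd, hζ, ← exp_int_mul, ← exp_nat_mul]
    simp only
    rw [mul_assoc (c m), ← exp_add]
    congr 2
    push_cast
    field_simp
    ring
  have hgeom : ∀ m : ℤ, ∑ j ∈ Finset.range (2 * s), (ζ ^ (m - μ)) ^ j =
      if (2 * s : ℤ) ∣ m - μ then (2 * s : ℂ) else 0 := by
    intro m
    have hiff := hprim.zpow_eq_one_iff_dvd (m - μ)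
    push_cast at hiff
    split_ifs with h
    · rw [hiff.2 h]
      simp
    · have hne : ζ ^ (m - μ) ≠ 1 := fun h' => h (hiff.1 h')
      rw [geom_sum_eq hne, ← zpow_natCast, ← zpow_mul, mul_comm (m - μ), zpow_mul, zpow_natCast,
        hprim.pow_eq_one, one_zpow, sub_self, zero_div]
  have hζ0 : ζ ≠ 0 := exp_ne_zero _
  -- Summing the equations with weights `ζ^(-μj)` keeps only the frequencies congruent to `μ` modulo
  -- `2s`.
  have hsum : ∑ m ∈ S, d m * (if (2 * s : ℤ) ∣ m - μ then (2 * s : ℂ) else 0) = 0 := by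
    simp_rw [← hgeom, Finset.mul_sum]
    rw [Finset.sum_comm]
    refine Finset.sum_eq_zero fun j hj => ?_
    have h1 := hvan j (Finset.mem_range.1 hj)
    simp_rw [hexp] at h1
    have h2 : ∀ m ∈ S, d m * (ζ ^ (m - μ)) ^ j = (ζ ^ (-μ)) ^ j * (d m * (ζ ^ m) ^ j) := by
      intro m _
      rw [sub_eq_add_neg, zpow_add₀ hζ0, mul_pow]
      ring
    rw [Finset.sum_congr rfl h2, ← Finset.mul_sum, h1, mul_zero]
  have hne : μ ≠ μ - 2 * s := by omega
  set f : ℤ → ℂ := fun m => d m * (if (2 * s : ℤ) ∣ m - μ then (2 * s : ℂ) else 0) with hf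
  have hd0 : ∀ m, c m = 0 → d m = 0 := fun m hm => by simp [hd, hm]
  have hpair : ∑ m ∈ S, f m = ∑ m ∈ ({μ, μ - 2 * s} : Finset ℤ), f m := by
    rw [Finset.sum_subset (Finset.subset_union_left : S ⊆ S ∪ {μ, μ - 2 * s}),
      ← Finset.sum_subset (Finset.subset_union_right : {μ, μ - 2 * s} ⊆ S ∪ {μ, μ - 2 * s})]
    · intro m _ hm
      simp only [Finset.mem_insert, Finset.mem_singleton, not_or] at hm
      by_cases h : (2 * s : ℤ) ∣ m - μ
      · obtain ⟨k, hk⟩ := h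
        have : c m = 0 := by
          refine hc m ?_
          by_contra hlt
          push Not at hlt
          have h3 : (m.natAbs : ℤ) < 2 * s := by exact_mod_cast hlt
          have h4 : |m| < 2 * s := by rwa [Int.abs_eq_natAbs]
          obtain ⟨h5, h6⟩ := abs_lt.1 h4
          have hs' : (0 : ℤ) < 2 * s := by omega
          have k1 : k < 1 := by
            refine lt_of_mul_lt_mul_left ?_ hs'.le
            linarith
          have k2 : -2 < k := by
            refine lt_of_mul_lt_mul_left ?_ hs'.le
            linarith
          have : k = 0 ∨ k = -1 := by omega
          rcases this with rfl | rfl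
          · exact hm.1 (by linarith)
          · exact hm.2 (by linarith)
        simp [hf, hd0 m this]
      · simp [hf, h]
    · intro m _ hm
      simp [hf, hd0 m (hS m hm)]
  have hs2 : (2 * (s : ℂ)) ≠ 0 := mul_ne_zero two_ne_zero hs0
  rw [hpair, Finset.sum_pair hne] at hsum
  have h7 : (2 * s : ℤ) ∣ μ - 2 * s - μ := ⟨-1, by ring⟩
  simp only [hf, h7, sub_self, dvd_zero, if_true, ← add_mul] at hsum
  have h8 := (mul_eq_zero.1 hsum).resolve_right hs2
  -- Lowering the frequency by `2s` multiplies the phase of the shifted grid by `e^{-iαπ} = ε`.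
  have h9 : exp (((μ - 2 * s : ℤ) : ℂ) * (α * π / (2 * s)) * I) =
      exp (μ * (α * π / (2 * s)) * I) * ε := by
    rw [← hε, ← exp_add]
    congr 1
    push_cast
    field_simp
    ring
  simp only [hd, h9] at h8
  have h10 : exp (μ * (α * π / (2 * s)) * I) * (c μ + ε * c (μ - 2 * s)) = 0 := by
    linear_combination h8
  exact (mul_eq_zero.1 h10).resolve_left (exp_ne_zero _)

end Aliasing

/-! ### Fourier expansion of spherical polynomials -/

section Harmonics
open Complex Polynomial

/-- `sin^{|m|} θ cos^k θ e^{imφ}`. -/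
def harmonic (m : ℤ) (k : ℕ) (θ φ : ℝ) : ℂ :=
  (Real.sin θ : ℂ) ^ m.natAbs * (Real.cos θ : ℂ) ^ k * exp (m * φ * I)

def harmonicSpan (N : ℕ) : Submodule ℂ (ℝ → ℝ → ℂ) :=
  Submodule.span ℂ {f | ∃ (m : ℤ) (k : ℕ), m.natAbs + k < N ∧ f = harmonic m k}

lemma harmonic_mem {m : ℤ} {k N : ℕ} (h : m.natAbs + k < N) : harmonic m k ∈ harmonicSpan N :=
  Submodule.subset_span ⟨m, k, h, rfl⟩

lemma harmonicSpan_mono {M N : ℕ} (h : M ≤ N) : harmonicSpan M ≤ harmonicSpan N :=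
  Submodule.span_mono fun _ ⟨m, k, hmk, hf⟩ => ⟨m, k, hmk.trans_le h, hf⟩

lemma mul_mem_harmonicSpan_of_gen (g : ℝ → ℝ → ℂ) (d : ℕ)
    (hg : ∀ (m : ℤ) (k : ℕ), g * harmonic m k ∈ harmonicSpan (m.natAbs + k + d + 1))
    {N : ℕ} {f : ℝ → ℝ → ℂ} (hf : f ∈ harmonicSpan N) : g * f ∈ harmonicSpan (N + d) := by
  induction hf using Submodule.span_induction with
  | mem f hf =>
    obtain ⟨m, k, h, rfl⟩ := hf
    exact harmonicSpan_mono (by omega) (hg m k)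
  | zero => rw [mul_zero]; exact Submodule.zero_mem _
  | add f f' _ _ h h' => rw [mul_add]; exact Submodule.add_mem _ h h'
  | smul z f _ h => rw [mul_smul_comm]; exact Submodule.smul_mem _ z h

lemma cos_mul_mem {N : ℕ} {f : ℝ → ℝ → ℂ} (hf : f ∈ harmonicSpan N) :
    (fun θ _ => (Real.cos θ : ℂ)) * f ∈ harmonicSpan (N + 1) := by
  refine mul_mem_harmonicSpan_of_gen _ 1 (fun m k => ?_) hf
  have : (fun θ _ => (Real.cos θ : ℂ)) * harmonic m k = harmonic m (k + 1) := by
    funext θ φ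
    simp only [Pi.mul_apply, harmonic]
    ring
  rw [this]
  exact harmonic_mem (by omega)

/-- Multiplication by `sin θ e^{± iφ}`. -/
lemma sin_exp_mul_mem (e : ℤ) (he : e = 1 ∨ e = -1) {N : ℕ} {f : ℝ → ℝ → ℂ}
    (hf : f ∈ harmonicSpan N) :
    (fun (θ φ : ℝ) => (Real.sin θ : ℂ) * exp (e * φ * I)) * f ∈ harmonicSpan (N + 1) := by
  refine mul_mem_harmonicSpan_of_gen _ 1 (fun m k => ?_) hf
  have hexp : ∀ φ : ℝ, exp (e * φ * I) * exp (m * φ * I) = exp (((m + e : ℤ) : ℂ) * φ * I) := by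
    intro φ
    rw [← exp_add]
    congr 1
    push_cast
    ring
  by_cases hm : (m + e).natAbs = m.natAbs + 1
  · have : (fun (θ φ : ℝ) => (Real.sin θ : ℂ) * exp (e * φ * I)) * harmonic m k =
        harmonic (m + e) k := by
      funext θ φ
      simp only [Pi.mul_apply, harmonic]
      rw [← hexp, hm]
      ring
    rw [this]
    exact harmonic_mem (by omega)
  -- When `|m|` drops, two surplus factors `sin θ` appear and become `1 - cos² θ`; the total degree
  -- still grows by at most one.
  · have hm' : m.natAbs = (m + e).natAbs + 1 := by omega
    have : (fun (θ φ : ℝ) => (Real.sin θ : ℂ) * exp (e * φ * I)) * harmonic m k =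
        harmonic (m + e) k - harmonic (m + e) (k + 2) := by
      funext θ φ
      simp only [Pi.mul_apply, Pi.sub_apply, harmonic]
      rw [← hexp, hm']
      have h2 : (Real.sin θ : ℂ) ^ 2 = 1 - (Real.cos θ : ℂ) ^ 2 := by
        have := Real.sin_sq θ
        exact_mod_cast this
      linear_combination (Real.sin θ : ℂ) ^ (m + e).natAbs * (Real.cos θ : ℂ) ^ k *
        exp (e * φ * I) * exp (m * φ * I) * h2
    rw [this]
    exact Submodule.sub_mem _ (harmonic_mem (by omega)) (harmonic_mem (by omega))

lemma x_mul_mem {N : ℕ} {f : ℝ → ℝ → ℂ} (hf : f ∈ harmonicSpan N) :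
    (fun θ φ => ((Real.sin θ * Real.cos φ : ℝ) : ℂ)) * f ∈ harmonicSpan (N + 1) := by
  have h1 := Submodule.smul_mem _ (1 / 2 : ℂ) (Submodule.add_mem _
    (sin_exp_mul_mem 1 (Or.inl rfl) hf) (sin_exp_mul_mem (-1) (Or.inr rfl) hf))
  convert h1 using 1
  funext θ φ
  simp only [Pi.mul_apply, Pi.add_apply, Pi.smul_apply, smul_eq_mul]
  push_cast
  rw [Complex.cos]
  simp only [one_mul, neg_mul]
  ring

lemma y_mul_mem {N : ℕ} {f : ℝ → ℝ → ℂ} (hf : f ∈ harmonicSpan N) :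
    (fun θ φ => ((Real.sin θ * Real.sin φ : ℝ) : ℂ)) * f ∈ harmonicSpan (N + 1) := by
  have h1 := Submodule.smul_mem _ (I / 2 : ℂ) (Submodule.sub_mem _
    (sin_exp_mul_mem (-1) (Or.inr rfl) hf) (sin_exp_mul_mem 1 (Or.inl rfl) hf))
  convert h1 using 1
  funext θ φ
  simp only [Pi.mul_apply, Pi.sub_apply, Pi.smul_apply, smul_eq_mul]
  push_cast
  rw [Complex.sin.eq_def (φ : ℂ)]
  simp only [one_mul, neg_mul]
  ring

lemma pow_mul_mem (g : ℝ → ℝ → ℂ)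
    (hg : ∀ {N : ℕ} {f : ℝ → ℝ → ℂ}, f ∈ harmonicSpan N → g * f ∈ harmonicSpan (N + 1))
    (d : ℕ) {N : ℕ} {f : ℝ → ℝ → ℂ} (hf : f ∈ harmonicSpan N) :
    g ^ d * f ∈ harmonicSpan (N + d) := by
  induction d with
  | zero => simpa using hf
  | succ d ih =>
    rw [pow_succ', mul_assoc]
    exact hg ih

lemma comp_sphericalPoint_mem {n : ℕ} {T : S2 → ℝ} (hT : T ∈ sphericalPolys n) :
    (fun θ φ => (T (sphericalPoint θ φ) : ℂ)) ∈ harmonicSpan (n + 1) := by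
  obtain ⟨p, hp, rfl⟩ := hT
  have hp' := (MvPolynomial.mem_restrictTotalDegree _ _ _).1 hp
  have hone : (1 : ℝ → ℝ → ℂ) ∈ harmonicSpan 1 := by
    have : harmonic 0 0 = 1 := by funext θ φ; simp [harmonic]
    rw [← this]
    exact harmonic_mem (by simp)
  have hval : (fun θ φ => ((restrictToSphere p (sphericalPoint θ φ) : ℝ) : ℂ)) =
      ∑ e ∈ p.support, ((p.coeff e : ℝ) : ℂ) •
        ((fun θ φ => ((Real.sin θ * Real.cos φ : ℝ) : ℂ)) ^ e 0 *
          ((fun θ φ => ((Real.sin θ * Real.sin φ : ℝ) : ℂ)) ^ e 1 *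
            ((fun θ _ => (Real.cos θ : ℂ)) ^ e 2 * (1 : ℝ → ℝ → ℂ)))) := by
    funext θ φ
    have h0 : restrictToSphere p (sphericalPoint θ φ) =
        MvPolynomial.aeval (R := ℝ)
          (fun i : Fin 3 => (sphericalPoint θ φ : EuclideanSpace ℝ (Fin 3)) i) p := rfl
    rw [h0, MvPolynomial.aeval_eq_eval]
    rw [MvPolynomial.eval_eq']
    simp [Finset.sum_apply, Fin.prod_univ_three, sphericalPoint, mul_assoc]
  rw [hval]
  refine Submodule.sum_mem _ fun e he => Submodule.smul_mem _ _ ?_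
  have hdeg : e 0 + e 1 + e 2 ≤ n := by
    have h1 := (MvPolynomial.le_totalDegree he).trans hp'
    rwa [Finsupp.sum_fintype _ _ (fun _ => rfl), Fin.sum_univ_three] at h1
  refine harmonicSpan_mono (M := 1 + e 2 + e 1 + e 0) (by omega) ?_
  exact pow_mul_mem _ x_mul_mem _ (pow_mul_mem _ y_mul_mem _ (pow_mul_mem _ cos_mul_mem _ hone))

/-- `∑_m sin^{|m|} θ (a_m(cos θ) + i b_m(cos θ)) e^{imφ}`. -/
def harmonicSum (S : Finset ℤ) (a b : ℤ → ℝ[X]) (θ φ : ℝ) : ℂ :=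
  ∑ m ∈ S, ((Real.sin θ : ℂ) ^ m.natAbs *
    (((a m).eval (Real.cos θ) : ℝ) + ((b m).eval (Real.cos θ) : ℝ) * I)) * exp (m * φ * I)

/-- The degree bounds on the coefficients of a spherical polynomial of degree less than `N`. -/
def CoeffBound (N : ℕ) (a : ℤ → ℝ[X]) : Prop :=
  ∀ m, (a m).degree < (N - m.natAbs : ℕ)

lemma CoeffBound.eq_zero {N : ℕ} {a : ℤ → ℝ[X]} (ha : CoeffBound N a) {m : ℤ}
    (hm : N ≤ m.natAbs) : a m = 0 := by
  have := ha m
  rwa [Nat.sub_eq_zero_of_le hm, Nat.cast_zero, Nat.WithBot.lt_zero_iff,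
    degree_eq_bot] at this

lemma CoeffBound.add {N : ℕ} {a b : ℤ → ℝ[X]} (ha : CoeffBound N a) (hb : CoeffBound N b) :
    CoeffBound N (a + b) := fun m => (degree_add_le _ _).trans_lt (max_lt (ha m) (hb m))

lemma CoeffBound.smul {N : ℕ} {a : ℤ → ℝ[X]} (ha : CoeffBound N a) (c : ℝ) :
    CoeffBound N (c • a) := fun m => (degree_smul_le _ _).trans_lt (ha m)

/-- Complex coefficients are split into real polynomials `a`, `b` because the positivity argument
behind `pair_eq_zero` is real. -/
lemma exists_harmonicSum {N : ℕ} {S : Finset ℤ} (hS : ∀ m : ℤ, m.natAbs < N → m ∈ S)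
    {f : ℝ → ℝ → ℂ} (hf : f ∈ harmonicSpan N) :
    ∃ a b, CoeffBound N a ∧ CoeffBound N b ∧ f = harmonicSum S a b := by
  have hzero : CoeffBound N 0 := fun m => by simp
  induction hf using Submodule.span_induction with
  | mem f hf =>
    obtain ⟨m, k, h, rfl⟩ := hf
    refine ⟨Pi.single m (X ^ k), 0, fun m' => ?_, hzero, ?_⟩
    · by_cases hm : m' = m
      · subst hm
        rw [Pi.single_eq_same, degree_X_pow]
        exact_mod_cast (by omega : k < N - m'.natAbs)
      · rw [Pi.single_eq_of_ne hm]
        simp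
    · funext θ φ
      rw [harmonicSum, Finset.sum_eq_single m]
      · simp [harmonic]
      · intro m' _ hm
        simp [Pi.single_eq_of_ne hm]
      · intro hm
        exact absurd (hS m (by omega)) hm
  | zero =>
    refine ⟨0, 0, hzero, hzero, ?_⟩
    funext θ φ
    simp [harmonicSum]
  | add f f' _ _ h h' =>
    obtain ⟨a, b, ha, hb, rfl⟩ := h
    obtain ⟨a', b', ha', hb', rfl⟩ := h'
    refine ⟨a + a', b + b', ha.add ha', hb.add hb', ?_⟩
    funext θ φ
    simp only [harmonicSum, Pi.add_apply, ← Finset.sum_add_distrib, eval_add]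
    refine Finset.sum_congr rfl fun m _ => ?_
    push_cast
    ring
  | smul z f _ h =>
    obtain ⟨a, b, ha, hb, rfl⟩ := h
    refine ⟨z.re • a + (-z.im) • b, z.im • a + z.re • b, (ha.smul _).add (hb.smul _),
      (ha.smul _).add (hb.smul _), ?_⟩
    funext θ φ
    simp only [harmonicSum, Pi.add_apply, Pi.smul_apply, eval_add, eval_smul, smul_eq_mul,
      Finset.mul_sum]
    refine Finset.sum_congr rfl fun m _ => ?_
    conv_lhs => rw [← Complex.re_add_im z]
    simp only [ofReal_add, ofReal_mul, ofReal_neg]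
    linear_combination (Real.sin θ : ℂ) ^ m.natAbs * z.im * (eval (Real.cos θ) (b m) : ℝ) *
      exp (m * φ * I) * I_sq

end Harmonics

/-! ### Splitting off the nodal polynomial of a group of latitudes -/

section Factorization
open Polynomial

lemma exists_eq_nodal_mul (F : Finset ℝ) {p : ℝ[X]} {d : ℕ} (hp : p.degree < d)
    (hd : F.card ≤ d) (hF : ∀ x ∈ F, p.eval x = 0) :
    ∃ q : ℝ[X], q.degree < (d - F.card : ℕ) ∧ p = Lagrange.nodal F id * q := by
  have hmonic : (Lagrange.nodal F id : ℝ[X]).Monic := Lagrange.nodal_monic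
  have hmod : p %ₘ Lagrange.nodal F id = 0 := by
    refine eq_zero_of_degree_lt_of_eval_finset_eq_zero F ?_ fun x hx => ?_
    · have := degree_modByMonic_lt p hmonic
      rwa [Lagrange.degree_nodal] at this
    · have h1 := congrArg (eval x) (modByMonic_add_div p (Lagrange.nodal F id))
      have h2 : eval x (Lagrange.nodal F id) = 0 := Lagrange.eval_nodal_at_node (v := id) hx
      rw [eval_add, eval_mul, h2, hF x hx] at h1
      simpa using h1
  have heq : p = Lagrange.nodal F id * (p /ₘ Lagrange.nodal F id) := by
    have h1 := modByMonic_add_div p (Lagrange.nodal F id)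
    rw [hmod, zero_add] at h1
    exact h1.symm
  refine ⟨_, ?_, heq⟩
  set q := p /ₘ Lagrange.nodal F id
  by_cases hq : q = 0
  · simp [hq]
  · rw [heq, degree_mul, Lagrange.degree_nodal, degree_eq_natDegree hq] at hp
    rw [degree_eq_natDegree hq]
    norm_cast at *
    omega

/-- The coefficients at two frequencies coupled by aliasing, both larger than `s - l` in absolute
value, vanish. -/
lemma coupled_eq_zero {s : ℕ} (Z : Finset ℝ) (hl : Z.card ≤ s)
    (hZ : (∀ c ∈ Z, 0 < c) ∨ (∀ c ∈ Z, c < 0)) (hZ1 : ∀ c ∈ Z, c ^ 2 < 1)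
    {a : ℤ → ℝ[X]} (ha : CoeffBound (s + Z.card) a) {μ : ℤ}
    (h1 : ∀ c ∈ Z, √(1 - c ^ 2) ^ μ.natAbs * (a μ).eval c +
      √(1 - c ^ 2) ^ (μ - 2 * s).natAbs * (a (μ - 2 * s)).eval c = 0)
    (h2 : ∀ c ∈ Z, √(1 - c ^ 2) ^ μ.natAbs * (a μ).eval (-c) -
      √(1 - c ^ 2) ^ (μ - 2 * s).natAbs * (a (μ - 2 * s)).eval (-c) = 0)
    (hμ1 : (s : ℤ) - Z.card < μ) (hμ2 : μ < s + Z.card) : a μ = 0 ∧ a (μ - 2 * s) = 0 := by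
  have hsq : ∀ c ∈ Z, ∀ r : ℕ, √(1 - c ^ 2) ^ (2 * r) = (1 - c ^ 2) ^ r := fun c hc r => by
    rw [pow_mul, Real.sq_sqrt (by linarith [hZ1 c hc])]
  have hne : ∀ c ∈ Z, ∀ k : ℕ, √(1 - c ^ 2) ^ k ≠ 0 := fun c hc k =>
    pow_ne_zero _ (Real.sqrt_pos.2 (by linarith [hZ1 c hc])).ne'
  rcases le_total μ s with hμ | hμ
  -- Here `μ = s - r` and `|μ - 2s| = s + r`, so dividing by the common power of the sine leaves `(1
  -- - c²)^r`, and the degree bounds become `l + r` and `l - r` with `l = Z.card`. For `μ ≥ s` the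
  -- two coefficients exchange roles.
  · obtain ⟨r, hr⟩ := Int.eq_ofNat_of_zero_le (sub_nonneg.2 hμ)
    have e : (μ - 2 * s).natAbs = μ.natAbs + 2 * r := by omega
    refine pair_eq_zero Z hZ r (by omega) _ _ (degree_lt_of_le (ha μ) (by omega))
      (degree_lt_of_le (ha _) (by omega)) (fun c hc => ?_) (fun c hc => ?_)
    · have := h1 c hc
      rw [e, pow_add, hsq c hc] at this
      refine (mul_eq_zero.1 ?_).resolve_left (hne c hc μ.natAbs)
      linear_combination this
    · have := h2 c hc
      rw [e, pow_add, hsq c hc] at this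
      refine (mul_eq_zero.1 ?_).resolve_left (hne c hc μ.natAbs)
      linear_combination this
  · obtain ⟨r, hr⟩ := Int.eq_ofNat_of_zero_le (sub_nonneg.2 hμ)
    have e : μ.natAbs = (μ - 2 * s).natAbs + 2 * r := by omega
    refine (pair_eq_zero Z hZ r (by omega) _ _ (degree_lt_of_le (ha _) (by omega))
      (degree_lt_of_le (ha μ) (by omega)) (fun c hc => ?_) (fun c hc => ?_)).symm
    · have := h1 c hc
      rw [e, pow_add, hsq c hc] at this
      refine (mul_eq_zero.1 ?_).resolve_left (hne c hc (μ - 2 * s).natAbs)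
      linear_combination this
    · have := h2 c hc
      rw [e, pow_add, hsq c hc] at this
      refine (mul_eq_zero.1 ?_).resolve_left (hne c hc (μ - 2 * s).natAbs)
      linear_combination -this

def symmetrize (Z : Finset ℝ) : Finset ℝ := Z ∪ Z.image (fun c => -c)

lemma card_symmetrize {Z : Finset ℝ} (hZ : (∀ c ∈ Z, 0 < c) ∨ (∀ c ∈ Z, c < 0)) :
    (symmetrize Z).card = 2 * Z.card := by
  rw [symmetrize, Finset.card_union_of_disjoint, Finset.card_image_of_injective _ neg_injective,
    two_mul]
  rw [Finset.disjoint_left]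
  intro a ha hb
  obtain ⟨b, hb, hab⟩ := Finset.mem_image.1 hb
  rcases hZ with hZ | hZ <;> have h1 := hZ a ha <;> have h2 := hZ b hb <;> linarith

/-- For `|m| ≤ s - Z.card` the aliased partner has frequency at least `s + Z.card` in absolute
value, hence is zero, and `a m` vanishes on all of `symmetrize Z`. Every other coefficient is zero,
by its degree bound or by `coupled_eq_zero`. -/
lemma exists_coeff_factor {s : ℕ} (Z : Finset ℝ) (hs : 0 < s) (hl : Z.card ≤ s)
    (hZ : (∀ c ∈ Z, 0 < c) ∨ (∀ c ∈ Z, c < 0)) (hZ1 : ∀ c ∈ Z, c ^ 2 < 1)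
    {a : ℤ → ℝ[X]} (ha : CoeffBound (s + Z.card) a)
    (h1 : ∀ μ : ℤ, 0 ≤ μ → μ < 2 * s → ∀ c ∈ Z, √(1 - c ^ 2) ^ μ.natAbs * (a μ).eval c +
      √(1 - c ^ 2) ^ (μ - 2 * s).natAbs * (a (μ - 2 * s)).eval c = 0)
    (h2 : ∀ μ : ℤ, 0 ≤ μ → μ < 2 * s → ∀ c ∈ Z, √(1 - c ^ 2) ^ μ.natAbs * (a μ).eval (-c) -
      √(1 - c ^ 2) ^ (μ - 2 * s).natAbs * (a (μ - 2 * s)).eval (-c) = 0) :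
    ∃ q, CoeffBound (s - Z.card) q ∧ ∀ m, a m = Lagrange.nodal (symmetrize Z) id * q m := by
  have hne : ∀ c ∈ Z, ∀ k : ℕ, √(1 - c ^ 2) ^ k ≠ 0 := fun c hc k =>
    pow_ne_zero _ (Real.sqrt_pos.2 (by linarith [hZ1 c hc])).ne'
  have key : ∀ m : ℤ, ∃ q : ℝ[X], q.degree < (s - Z.card - m.natAbs : ℕ) ∧
      a m = Lagrange.nodal (symmetrize Z) id * q := by
    intro m
    by_cases hm : m.natAbs + Z.card ≤ s
    · have hroot : ∀ x ∈ symmetrize Z, (a m).eval x = 0 := by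
        rcases le_or_gt 0 m with h0 | h0
        · have hz : a (m - 2 * s) = 0 := ha.eq_zero (by omega)
          intro x hx
          rcases Finset.mem_union.1 hx with hx | hx
          · have := h1 m h0 (by omega) x hx
            rw [hz, eval_zero, mul_zero, add_zero] at this
            exact (mul_eq_zero.1 this).resolve_left (hne x hx _)
          · obtain ⟨c, hc, rfl⟩ := Finset.mem_image.1 hx
            have := h2 m h0 (by omega) c hc
            rw [hz, eval_zero, mul_zero, sub_zero] at this
            exact (mul_eq_zero.1 this).resolve_left (hne c hc _)
        -- A negative frequency occurs as the second member of the pair with `μ = m + 2s`.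
        · have hz : a (m + 2 * s) = 0 := ha.eq_zero (by omega)
          have e : m + 2 * (s : ℤ) - 2 * s = m := by ring
          intro x hx
          rcases Finset.mem_union.1 hx with hx | hx
          · have := h1 (m + 2 * s) (by omega) (by omega) x hx
            rw [e, hz, eval_zero, mul_zero, zero_add] at this
            exact (mul_eq_zero.1 this).resolve_left (hne x hx _)
          · obtain ⟨c, hc, rfl⟩ := Finset.mem_image.1 hx
            have := h2 (m + 2 * s) (by omega) (by omega) c hc
            rw [e, hz, eval_zero, mul_zero, zero_sub, neg_eq_zero] at this
            exact (mul_eq_zero.1 this).resolve_left (hne c hc _)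
      obtain ⟨q, hq, hq'⟩ := exists_eq_nodal_mul (symmetrize Z) (ha m)
        (by rw [card_symmetrize hZ]; omega) hroot
      refine ⟨q, degree_lt_of_le hq ?_, hq'⟩
      rw [card_symmetrize hZ]
      omega
    · have hz : a m = 0 := by
        by_cases hm' : s + Z.card ≤ m.natAbs
        · exact ha.eq_zero hm'
        · rcases le_or_gt 0 m with h0 | h0
          · exact (coupled_eq_zero Z hl hZ hZ1 ha (h1 m h0 (by omega)) (h2 m h0 (by omega))
              (by omega) (by omega)).1
          · have := (coupled_eq_zero Z hl hZ hZ1 ha (h1 (m + 2 * s) (by omega) (by omega))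
              (h2 (m + 2 * s) (by omega) (by omega)) (by omega) (by omega)).2
            rwa [add_sub_cancel_right] at this
      exact ⟨0, by simp, by simp [hz]⟩
  choose q hq hq' using key
  exact ⟨q, hq, hq'⟩

/-- As `ε` is real, the coupling holds separately for real and imaginary parts. -/
lemma aliased_of_vanish {s N : ℕ} (hs : 0 < s) (hN : N ≤ 2 * s) (α : ℝ) (ε : ℝ)
    (hε : Complex.exp (-(α * π * Complex.I)) = ε)
    {S : Finset ℤ} (hS : ∀ m : ℤ, m.natAbs < N → m ∈ S) {a b : ℤ → ℝ[X]} (ha : CoeffBound N a)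
    (hb : CoeffBound N b) {c : ℝ} (hc1 : -1 ≤ c) (hc2 : c ≤ 1)
    (hvan : ∀ φ ∈ Theta α s, harmonicSum S a b (Real.arccos c) φ = 0)
    (μ : ℤ) (hμ0 : 0 ≤ μ) (hμ : μ < 2 * s) :
    (√(1 - c ^ 2) ^ μ.natAbs * (a μ).eval c +
      ε * (√(1 - c ^ 2) ^ (μ - 2 * s).natAbs * (a (μ - 2 * s)).eval c) = 0) ∧
    (√(1 - c ^ 2) ^ μ.natAbs * (b μ).eval c +
      ε * (√(1 - c ^ 2) ^ (μ - 2 * s).natAbs * (b (μ - 2 * s)).eval c) = 0) := by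
  have hz : ∀ m : ℤ, N ≤ m.natAbs → ((√(1 - c ^ 2) : ℝ) : ℂ) ^ m.natAbs *
      (((a m).eval c : ℝ) + ((b m).eval c : ℝ) * Complex.I) = 0 := fun m hm => by
    simp [ha.eq_zero hm, hb.eq_zero hm]
  have h := coeff_add_aliased_eq_zero hs α ε hε S (fun m => ((√(1 - c ^ 2) : ℝ) : ℂ) ^ m.natAbs *
    (((a m).eval c : ℝ) + ((b m).eval c : ℝ) * Complex.I))
    (fun m hm => hz m (by by_contra hlt; exact hm (hS m (by omega))))
    (fun m hm => hz m (by omega)) (fun j hj => by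
      have := hvan _ ⟨j, hj, rfl⟩
      rwa [harmonicSum, Real.sin_arccos, Real.cos_arccos hc1 hc2] at this) μ hμ0 hμ
  have h' : ((√(1 - c ^ 2) ^ μ.natAbs * (a μ).eval c +
      ε * (√(1 - c ^ 2) ^ (μ - 2 * s).natAbs * (a (μ - 2 * s)).eval c) : ℝ) : ℂ) +
    ((√(1 - c ^ 2) ^ μ.natAbs * (b μ).eval c +
      ε * (√(1 - c ^ 2) ^ (μ - 2 * s).natAbs * (b (μ - 2 * s)).eval c) : ℝ) : ℂ) * Complex.I
      = 0 := by
    push_cast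
    linear_combination h
  constructor
  · simpa only [Complex.add_re, Complex.mul_re,
      Complex.ofReal_re, Complex.ofReal_im, Complex.I_re, Complex.I_im, mul_zero, zero_mul,
      sub_zero, add_zero, Complex.zero_re] using congrArg Complex.re h'
  · simpa only [Complex.add_im, Complex.mul_im, mul_one,
      Complex.ofReal_re, Complex.ofReal_im, Complex.I_re, Complex.I_im, mul_zero, zero_mul,
      zero_add, add_zero, Complex.zero_im] using congrArg Complex.im h'

/-- A spherical polynomial that vanishes on a group of latitudes has a factor in `cos θ`. -/
lemma exists_harmonicSum_factor {s : ℕ} (Z : Finset ℝ) (hs : 0 < s) (hl : Z.card ≤ s)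
    (hZ : (∀ c ∈ Z, 0 < c) ∨ (∀ c ∈ Z, c < 0)) (hZ1 : ∀ c ∈ Z, c ^ 2 < 1)
    {S : Finset ℤ} (hS : ∀ m : ℤ, m.natAbs < s + Z.card → m ∈ S)
    {a b : ℤ → ℝ[X]} (ha : CoeffBound (s + Z.card) a) (hb : CoeffBound (s + Z.card) b)
    (h0 : ∀ c ∈ Z, ∀ φ ∈ Theta 0 s, harmonicSum S a b (Real.arccos c) φ = 0)
    (h1 : ∀ c ∈ Z, ∀ φ ∈ Theta 1 s, harmonicSum S a b (Real.arccos (-c)) φ = 0) :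
    ∃ a' b', CoeffBound (s - Z.card) a' ∧ CoeffBound (s - Z.card) b' ∧ ∀ θ φ,
      harmonicSum S a b θ φ = ((Lagrange.nodal (symmetrize Z) id).eval (Real.cos θ) : ℝ) *
        harmonicSum S a' b' θ φ := by
  have e0 : Complex.exp (-(((0 : ℝ) : ℂ) * π * Complex.I)) = ((1 : ℝ) : ℂ) := by simp
  -- The half-step rotation of the grid on the reflected latitudes produces the opposite sign that
  -- `pair_eq_zero` requires.
  have e1 : Complex.exp (-(((1 : ℝ) : ℂ) * π * Complex.I)) = ((-1 : ℝ) : ℂ) := by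
    simp [Complex.exp_neg]
  have hN : s + Z.card ≤ 2 * s := by omega
  have hb1 : ∀ c ∈ Z, -1 ≤ c ∧ c ≤ 1 := fun c hc => abs_le.1 (sq_le_one_iff_abs_le_one c |>.1
    (hZ1 c hc).le)
  have k0 := fun c (hc : c ∈ Z) => aliased_of_vanish hs hN 0 1 e0 hS ha hb (hb1 c hc).1
    (hb1 c hc).2 (h0 c hc)
  have k1 := fun c (hc : c ∈ Z) => aliased_of_vanish hs hN 1 (-1) e1 hS ha hb
    (c := -c) (by linarith [(hb1 c hc).2]) (by linarith [(hb1 c hc).1]) (h1 c hc)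
  simp only [neg_sq, one_mul, neg_mul, ← sub_eq_add_neg] at k0 k1
  obtain ⟨a', ha', haeq⟩ := exists_coeff_factor Z hs hl hZ hZ1 ha
    (fun μ hμ0 hμ c hc => (k0 c hc μ hμ0 hμ).1) (fun μ hμ0 hμ c hc => (k1 c hc μ hμ0 hμ).1)
  obtain ⟨b', hb', hbeq⟩ := exists_coeff_factor Z hs hl hZ hZ1 hb
    (fun μ hμ0 hμ c hc => (k0 c hc μ hμ0 hμ).2) (fun μ hμ0 hμ c hc => (k1 c hc μ hμ0 hμ).2)
  refine ⟨a', b', ha', hb', fun θ φ => ?_⟩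
  simp only [harmonicSum, Finset.mul_sum]
  refine Finset.sum_congr rfl fun m _ => ?_
  rw [haeq, hbeq, eval_mul, eval_mul]
  push_cast
  ring

end Factorization

/-! ### Lower bound for the dimension, and reduction to unisolvence -/

section Dimension
open MvPolynomial

/-- The exponents `(i, j)` with `i + j < d`. -/
def exponents (d : ℕ) : Finset (ℕ × ℕ) := (Finset.range d).biUnion Finset.HasAntidiagonal.antidiagonal

lemma mem_exponents {d : ℕ} {e : ℕ × ℕ} : e ∈ exponents d ↔ e.1 + e.2 < d := by
  simp [exponents]

lemma two_mul_card_exponents (d : ℕ) : 2 * (exponents d).card = d * (d + 1) := by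
  rw [exponents, Finset.card_biUnion]
  · simp only [Finset.Nat.card_antidiagonal]
    induction d with
    | zero => rfl
    | succ d ih =>
      rw [Finset.sum_range_succ, mul_add, ih]
      ring
  · intro i _ j _ hij
    rw [Function.onFun, Finset.disjoint_left]
    intro e h1 h2
    rw [Finset.HasAntidiagonal.mem_antidiagonal] at h1 h2
    exact hij (h1.symm.trans h2)

lemma coeff_eq_zero_of_vanish_on_disc (J : Finset (ℕ × ℕ)) (g : J → ℝ)
    (h : ∀ x y : ℝ, x ^ 2 + y ^ 2 < 1 → ∑ e : J, g e * (x ^ e.1.1 * y ^ e.1.2) = 0) (e : J) :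
    g e = 0 := by
  set v : ℕ × ℕ → Fin 2 →₀ ℕ := fun e => Finsupp.equivFunOnFinite.symm ![e.1, e.2] with hv
  have hinj : Function.Injective v := by
    intro e e' hee
    have h0 := DFunLike.congr_fun hee 0
    have h1 := DFunLike.congr_fun hee 1
    simp [hv] at h0 h1
    exact Prod.ext h0 h1
  set p : MvPolynomial (Fin 2) ℝ := ∑ e : J, monomial (v e.1) (g e) with hp
  have hp0 : p = 0 := by
    -- The square of half-width `1/2` lies inside the unit disc, and a product of infinite sets
    -- determines a polynomial.
    refine MvPolynomial.funext_set (fun _ => Set.Ioo (-1 / 2 : ℝ) (1 / 2))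
      (fun _ => Set.Ioo_infinite (by norm_num)) fun x hx => ?_
    have b0 := hx 0 trivial
    have b1 := hx 1 trivial
    simp only [Set.mem_Ioo] at b0 b1
    have := h (x 0) (x 1) (by nlinarith [b0.1, b0.2, b1.1, b1.2])
    rw [map_zero, ← this, hp, map_sum]
    refine Finset.sum_congr rfl fun e _ => ?_
    rw [eval_monomial, Finsupp.prod_fintype _ _ (fun _ => pow_zero _), Fin.prod_univ_two]
    simp [hv]
  have hc : coeff (v e.1) p = g e := by
    rw [hp, coeff_sum, Finset.sum_eq_single e]
    · simp
    · intro e' _ hne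
      rw [coeff_monomial, if_neg]
      intro heq
      exact hne (Subtype.ext (hinj heq))
    · simp
  rw [← hc, hp0, coeff_zero]

/-- The monomials `x^i y^j` with `i + j ≤ n` and `z x^i y^j` with `i + j < n` number `(n+1)²`. They
are independent on the sphere: the reflection `z ↦ -z` separates the two families, and each then
gives a polynomial vanishing on the open disc. -/
lemma sq_le_finrank_sphericalPolys (n : ℕ) :
    (n + 1) ^ 2 ≤ Module.finrank ℝ (sphericalPolys n) := by
  have : Module.Finite ℝ (sphericalPolys n) := by
    unfold sphericalPolys
    infer_instance
  set P : exponents (n + 1) ⊕ exponents n → MvPolynomial (Fin 3) ℝ :=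
    Sum.elim (fun e => X 0 ^ e.1.1 * X 1 ^ e.1.2) (fun e => X 2 * (X 0 ^ e.1.1 * X 1 ^ e.1.2))
    with hP
  have hdeg2 : ∀ i j : ℕ, (X 0 ^ i * X 1 ^ j : MvPolynomial (Fin 3) ℝ).totalDegree ≤ i + j := by
    intro i j
    refine (totalDegree_mul _ _).trans ?_
    rw [totalDegree_X_pow, totalDegree_X_pow]
  have hdeg : ∀ e, restrictToSphere (P e) ∈ sphericalPolys n := by
    intro e
    refine ⟨P e, (mem_restrictTotalDegree _ _ _).2 ?_, rfl⟩
    rcases e with e | e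
    · have := mem_exponents.1 e.2
      exact (hdeg2 _ _).trans (by omega)
    · have := mem_exponents.1 e.2
      refine (totalDegree_mul _ _).trans ?_
      have := hdeg2 e.1.1 e.1.2
      rw [totalDegree_X]
      omega
  have hli : LinearIndependent ℝ fun e => restrictToSphere (P e) := by
    rw [Fintype.linearIndependent_iff]
    intro g hg
    have hpt : ∀ x y z : ℝ, x ^ 2 + y ^ 2 + z ^ 2 = 1 →
        ∑ e : exponents (n + 1), g (Sum.inl e) * (x ^ e.1.1 * y ^ e.1.2) +
          z * ∑ e : exponents n, g (Sum.inr e) * (x ^ e.1.1 * y ^ e.1.2) = 0 := by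
      intro x y z hxyz
      have hmem : (!₂[x, y, z] : EuclideanSpace ℝ (Fin 3)) ∈
          Metric.sphere (0 : EuclideanSpace ℝ (Fin 3)) 1 := by
        rw [mem_sphere_zero_iff_norm, EuclideanSpace.norm_eq, Real.sqrt_eq_one]
        simpa [Fin.sum_univ_three] using hxyz
      have h1 := congrFun hg (⟨_, hmem⟩ : S2)
      simp only [Fintype.sum_sum_type, Finset.sum_apply, Pi.smul_apply, smul_eq_mul, hP, Sum.elim_inl,
        Sum.elim_inr, restrictToSphere, LinearMap.pi_apply, AlgHom.toLinearMap_apply, map_mul,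
        map_pow, aeval_X, Pi.zero_apply] at h1
      rw [Finset.mul_sum]
      refine Eq.trans ?_ h1
      congr 1
      refine Finset.sum_congr rfl fun e _ => ?_
      simp
      ring
    have hsplit : ∀ x y : ℝ, x ^ 2 + y ^ 2 < 1 →
        ∑ e : exponents (n + 1), g (Sum.inl e) * (x ^ e.1.1 * y ^ e.1.2) = 0 ∧
          ∑ e : exponents n, g (Sum.inr e) * (x ^ e.1.1 * y ^ e.1.2) = 0 := by
      intro x y hxy
      have hpos : 0 < 1 - x ^ 2 - y ^ 2 := by linarith
      have hsq := Real.sq_sqrt hpos.le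
      have h1 := hpt x y (√(1 - x ^ 2 - y ^ 2)) (by linarith)
      have h2 := hpt x y (-√(1 - x ^ 2 - y ^ 2)) (by rw [neg_sq]; linarith)
      refine ⟨by linarith, ?_⟩
      refine (mul_eq_zero.1 ?_).resolve_left (Real.sqrt_pos.2 hpos).ne'
      linarith
    rintro (e | e)
    · exact coeff_eq_zero_of_vanish_on_disc _ (fun e => g (Sum.inl e))
        (fun x y h => (hsplit x y h).1) e
    · exact coeff_eq_zero_of_vanish_on_disc _ (fun e => g (Sum.inr e))
        (fun x y h => (hsplit x y h).2) e
  have hli' : LinearIndependent ℝ fun e =>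
      (⟨restrictToSphere (P e), hdeg e⟩ : sphericalPolys n) :=
    LinearIndependent.of_comp (sphericalPolys n).subtype hli
  have hcard := hli'.fintype_card_le_finrank
  rw [Fintype.card_sum, Fintype.card_coe, Fintype.card_coe] at hcard
  have c1 := two_mul_card_exponents (n + 1)
  have c2 := two_mul_card_exponents n
  nlinarith

end Dimension

/-- A set of at most `(n+1)²` points on which only the zero spherical polynomial vanishes solves
the interpolation problem. -/
lemma solvesInterpolation_of_unisolvent {n : ℕ} {X : Set S2} (hfin : X.Finite)
    (hcard : X.ncard ≤ (n + 1) ^ 2)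
    (huni : ∀ T ∈ sphericalPolys n, (∀ x ∈ X, T x = 0) → T = 0) : SolvesInterpolation n X := by
  have : Fintype X := hfin.fintype
  have : Module.Finite ℝ (sphericalPolys n) := by
    unfold sphericalPolys
    infer_instance
  set ev : sphericalPolys n →ₗ[ℝ] (X → ℝ) :=
    (LinearMap.funLeft ℝ ℝ (Subtype.val : X → S2)).comp (sphericalPolys n).subtype with hev
  have hinj : Function.Injective ev := by
    rw [← LinearMap.ker_eq_bot, LinearMap.ker_eq_bot']
    intro T hT
    exact Subtype.ext (huni T.1 T.2 fun x hx => congrFun hT ⟨x, hx⟩)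
  have h1 := LinearMap.finrank_le_finrank_of_injective hinj
  have h2 := sq_le_finrank_sphericalPolys n
  have h3 : X.ncard = Fintype.card X := by rw [← Nat.card_coe_set_eq, Nat.card_eq_fintype_card]
  have h4 : Module.finrank ℝ (X → ℝ) = Fintype.card X := Module.finrank_fintype_fun_eq_card ℝ
  -- The chain `(n+1)² ≤ dim Π_n ≤ |X| ≤ (n+1)²` forces equality throughout.
  have hsurj : Function.Surjective ev :=
    (LinearMap.injective_iff_surjective_of_finrank_eq_finrank (by omega)).1 hinj
  refine ⟨by omega, fun f => ?_⟩
  obtain ⟨T, hT⟩ := hsurj f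
  refine ⟨T.1, ⟨T.2, fun x => congrFun hT x⟩, ?_⟩
  rintro T' ⟨hT', hx⟩
  have : ev ⟨T', hT'⟩ = ev T := by
    rw [hT]
    funext x
    exact hx x
  exact congrArg Subtype.val (hinj this)

/-! ### Counting the nodes -/

section Counting
variable {n σ : ℕ} {lam : ℕ → ℕ}

lemma degrees_add_sum (k : ℕ) (h : 2 * ∑ i ∈ Finset.Icc 1 k, lam i ≤ n) :
    degrees n lam k + 2 * ∑ i ∈ Finset.Icc 1 k, lam i = n := by
  induction k with
  | zero => simp [degrees]
  | succ k ih =>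
    rw [Finset.sum_Icc_succ_top (by omega)] at h ⊢
    have := ih (by omega)
    rw [degrees]
    omega

lemma sum_add_le_sum {k : ℕ} (hk : k < σ) :
    ∑ i ∈ Finset.Icc 1 k, lam i + lam (k + 1) ≤ ∑ i ∈ Finset.Icc 1 σ, lam i := by
  rw [← Finset.sum_Icc_succ_top (by omega)]
  exact Finset.sum_le_sum_of_subset (Finset.Icc_subset_Icc_right hk)

/-- This is `s + l = N` for the group `k + 1`, with `N = n + 1 - 2(λ_1 + ⋯ + λ_k)`. -/
lemma halfCount_add (hpos : ∀ k ∈ Finset.Icc 1 σ, 0 < lam k)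
    (hsum : 2 * ∑ k ∈ Finset.Icc 1 σ, lam k = n + 1) {k : ℕ} (hk : k < σ) :
    halfCount n lam (k + 1) + lam (k + 1) + 2 * ∑ i ∈ Finset.Icc 1 k, lam i = n + 1 := by
  have h1 := sum_add_le_sum (lam := lam) hk
  have h2 := hpos (k + 1) (Finset.mem_Icc.2 ⟨by omega, by omega⟩)
  have h3 := degrees_add_sum (n := n) (lam := lam) k (by omega)
  rw [halfCount, Nat.add_sub_cancel]
  omega

/-- The sum telescopes: a group contributes `4l(N - l) = N² - (N - 2l)²`. -/
lemma sum_count (hpos : ∀ k ∈ Finset.Icc 1 σ, 0 < lam k)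
    (hsum : 2 * ∑ k ∈ Finset.Icc 1 σ, lam k = n + 1) :
    ∑ k ∈ Finset.Icc 1 σ, 2 * lam k * (2 * halfCount n lam k) = (n + 1) ^ 2 := by
  have key : ∀ k ≤ σ, ∑ k ∈ Finset.Icc 1 k, 2 * lam k * (2 * halfCount n lam k) +
      (n + 1 - 2 * ∑ i ∈ Finset.Icc 1 k, lam i) ^ 2 = (n + 1) ^ 2 := by
    intro k
    induction k with
    | zero => simp
    | succ k ih =>
      intro hk
      have h1 := ih (by omega)
      have h2 := halfCount_add hpos hsum (k := k) (by omega)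
      have h3 := sum_add_le_sum (lam := lam) (k := k) (σ := σ) (by omega)
      rw [Finset.sum_Icc_succ_top (by omega), Finset.sum_Icc_succ_top (by omega), ← h1]
      obtain ⟨r, hr⟩ := Nat.exists_eq_add_of_le
        (show 2 * (∑ i ∈ Finset.Icc 1 k, lam i + lam (k + 1)) ≤ n + 1 by omega)
      have e1 : n + 1 - 2 * (∑ i ∈ Finset.Icc 1 k, lam i + lam (k + 1)) = r := by omega
      have e2 : n + 1 - 2 * ∑ i ∈ Finset.Icc 1 k, lam i = r + 2 * lam (k + 1) := by omega
      have e3 : halfCount n lam (k + 1) = r + lam (k + 1) := by omega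
      rw [e1, e2, e3]
      ring
  have := key σ le_rfl
  rwa [hsum, Nat.sub_self, zero_pow two_ne_zero, add_zero] at this

/-- An upper bound suffices, so no two nodes need to be shown distinct here. -/
lemma nodes_finite_and_card_le (θ : ℕ → ℕ → ℝ) (hpos : ∀ k ∈ Finset.Icc 1 σ, 0 < lam k)
    (hsum : 2 * ∑ k ∈ Finset.Icc 1 σ, lam k = n + 1) :
    (nodes n σ lam θ).Finite ∧ (nodes n σ lam θ).ncard ≤ (n + 1) ^ 2 := by
  classical
  set D : Finset (Σ _ : ℕ, ℕ × ℕ) := (Finset.Icc 1 σ).sigma fun k =>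
    Finset.Icc 1 (2 * lam k) ×ˢ Finset.range (2 * halfCount n lam k) with hD
  set F : (Σ _ : ℕ, ℕ × ℕ) → S2 := fun t => sphericalPoint (θ t.2.1 t.1)
    ((2 * (t.2.2 : ℝ) + if t.2.1 ≤ lam t.1 then 0 else 1) * π / (2 * (halfCount n lam t.1 : ℝ)))
  have hsub : nodes n σ lam θ ⊆ (D.image F : Finset S2) := by
    rintro x ⟨k, hk, i, hi, φ, ⟨j, hj, rfl⟩, rfl⟩
    rw [Finset.mem_coe, Finset.mem_image]
    exact ⟨⟨k, i, j⟩, by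
      rw [hD, Finset.mem_sigma, Finset.mem_product, Finset.mem_range]
      exact ⟨hk, hi, hj⟩, rfl⟩
  refine ⟨(Finset.finite_toSet _).subset hsub, ?_⟩
  refine (Set.ncard_le_ncard hsub (Finset.finite_toSet _)).trans ?_
  rw [Set.ncard_coe_finset, ← sum_count hpos hsum]
  refine Finset.card_image_le.trans ?_
  rw [hD, Finset.card_sigma]
  simp

end Counting

lemma exists_sphericalPoint (x : S2) : ∃ θ φ, x = sphericalPoint θ φ := by
  obtain ⟨v, hv⟩ := x
  have hnorm : v 0 ^ 2 + v 1 ^ 2 + v 2 ^ 2 = 1 := by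
    have h := mem_sphere_zero_iff_norm.1 hv
    rw [EuclideanSpace.norm_eq, Real.sqrt_eq_one] at h
    simpa [Fin.sum_univ_three] using h
  set z : ℂ := ⟨v 0, v 1⟩ with hz
  have habs : ‖z‖ = √(1 - v 2 ^ 2) := by
    rw [← Real.sqrt_sq (norm_nonneg z), Complex.sq_norm, Complex.normSq_mk]
    congr 1
    linarith
  have hle : v 2 ^ 2 ≤ 1 := by nlinarith [sq_nonneg (v 0), sq_nonneg (v 1)]
  obtain ⟨b1, b2⟩ := abs_le.1 ((sq_le_one_iff_abs_le_one _).1 hle)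
  refine ⟨Real.arccos (v 2), z.arg, Subtype.ext ?_⟩
  ext i
  fin_cases i
  · have : v 0 = ‖z‖ * Real.cos z.arg := (Complex.norm_mul_cos_arg z).symm
    rwa [habs, ← Real.sin_arccos] at this
  · have : v 1 = ‖z‖ * Real.sin z.arg := (Complex.norm_mul_sin_arg z).symm
    rwa [habs, ← Real.sin_arccos] at this
  · simp [sphericalPoint, Real.cos_arccos b1 b2]

end SphereInterpolation
end

/-! ### The main theorem, by removing one group of latitudes at a time -/

open SphereInterpolation in
theorem theorem3p1 (n : ℕ) (hn : Odd n) (σ : ℕ) (lam : ℕ → ℕ)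
    (hpos : ∀ k ∈ Finset.Icc 1 σ, 0 < lam k)
    (hsum : ∑ k ∈ Finset.Icc 1 σ, lam k = (n + 1) / 2)
    (θ : ℕ → ℕ → ℝ)
    (hθ : ∀ k ∈ Finset.Icc 1 σ, ∀ i ∈ Finset.Icc 1 (2 * lam k), θ i k ∈ Set.Ioo 0 π)
    (hdist : ∀ k ∈ Finset.Icc 1 σ, ∀ i ∈ Finset.Icc 1 (2 * lam k),
      ∀ k' ∈ Finset.Icc 1 σ, ∀ i' ∈ Finset.Icc 1 (2 * lam k'),
        θ i k = θ i' k' → i = i' ∧ k = k')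
    (hsymm : ∀ k ∈ Finset.Icc 1 σ, ∀ i ∈ Finset.Icc 1 (lam k),
      θ (2 * lam k + 1 - i) k = π - θ i k)
    (hhemi : ∀ k ∈ Finset.Icc 1 σ,
      (∀ i ∈ Finset.Icc 1 (lam k), θ i k < π / 2) ∨
        (∀ i ∈ Finset.Icc 1 (lam k), π / 2 < θ i k)) :
    SphereInterpolation.SolvesInterpolation n (SphereInterpolation.nodes n σ lam θ) := by
  have hsum2 : 2 * ∑ k ∈ Finset.Icc 1 σ, lam k = n + 1 := by
    obtain ⟨m, rfl⟩ := hn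
    omega
  obtain ⟨hfin, hcard⟩ := nodes_finite_and_card_le θ hpos hsum2
  refine solvesInterpolation_of_unisolvent hfin hcard fun T hT hTX => ?_
  -- One frequency set serves all stages; only the coefficient bounds shrink.
  set S : Finset ℤ := Finset.Icc (-(n + 1 : ℤ)) (n + 1) with hS
  have hmemS : ∀ m : ℤ, m.natAbs < n + 1 → m ∈ S := by
    intro m hm
    rw [hS, Finset.mem_Icc]
    omega
  -- `W` is the product of the nodal polynomials split off so far; being nonzero on the remaining
  -- latitudes, it lets the cofactor inherit the zeros of `T` there.
  have key : ∀ k ≤ σ, ∃ a b : ℤ → Polynomial ℝ, ∃ W : Polynomial ℝ,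
      CoeffBound (n + 1 - 2 * ∑ i ∈ Finset.Icc 1 k, lam i) a ∧
      CoeffBound (n + 1 - 2 * ∑ i ∈ Finset.Icc 1 k, lam i) b ∧
      (∀ k' ∈ Finset.Icc 1 σ, k < k' → ∀ i ∈ Finset.Icc 1 (2 * lam k'),
        W.eval (Real.cos (θ i k')) ≠ 0) ∧
      ∀ t φ, (T (sphericalPoint t φ) : ℂ) =
        (W.eval (Real.cos t) : ℝ) * harmonicSum S a b t φ := by
    intro k
    induction k with
    | zero =>
      intro _
      obtain ⟨a, b, ha, hb, h⟩ := exists_harmonicSum hmemS (comp_sphericalPoint_mem hT)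
      refine ⟨a, b, 1, by simpa using ha, by simpa using hb, by simp, fun t φ => ?_⟩
      simpa using congrFun (congrFun h t) φ
    | succ k ih =>
      intro hk
      obtain ⟨a, b, W, ha, hb, hW, hT⟩ := ih (by omega)
      have hkmem : k + 1 ∈ Finset.Icc 1 σ := Finset.mem_Icc.2 ⟨by omega, hk⟩
      have hcount := halfCount_add hpos hsum2 (k := k) (by omega)
      have hle := sum_add_le_sum (lam := lam) (k := k) (σ := σ) (by omega)
      have hl0 := hpos _ hkmem
      set s := halfCount n lam (k + 1) with hs
      set l := lam (k + 1) with hl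
      have hup : ∀ i ∈ Finset.Icc 1 l, i ∈ Finset.Icc 1 (2 * l) := by
        intro i hi
        rw [Finset.mem_Icc] at hi ⊢
        omega
      have hrefl : ∀ i ∈ Finset.Icc 1 l, 2 * l + 1 - i ∈ Finset.Icc 1 (2 * l) := by
        intro i hi
        rw [Finset.mem_Icc] at hi ⊢
        omega
      have hIcc : ∀ k' ∈ Finset.Icc 1 σ, ∀ i ∈ Finset.Icc 1 (2 * lam k'),
          θ i k' ∈ Set.Icc 0 π := fun k' hk' i hi => Set.Ioo_subset_Icc_self (hθ k' hk' i hi)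
      have hnegcos : ∀ i ∈ Finset.Icc 1 l,
          -Real.cos (θ i (k + 1)) = Real.cos (θ (2 * l + 1 - i) (k + 1)) := fun i hi => by
        rw [hsymm _ hkmem i hi, Real.cos_pi_sub]
      set Z : Finset ℝ := (Finset.Icc 1 l).image fun i => Real.cos (θ i (k + 1)) with hZ
      have hZcard : Z.card = l := by
        rw [hZ, Finset.card_image_of_injOn, Nat.card_Icc, Nat.add_sub_cancel]
        intro i hi j hj hij
        exact (hdist _ hkmem i (hup i hi) _ hkmem j (hup j hj)
          (Real.injOn_cos (hIcc _ hkmem i (hup i hi)) (hIcc _ hkmem j (hup j hj)) hij)).1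
      have hside : (∀ c ∈ Z, 0 < c) ∨ (∀ c ∈ Z, c < 0) := by
        refine (hhemi _ hkmem).imp (fun h c hc => ?_) (fun h c hc => ?_) <;>
          obtain ⟨i, hi, rfl⟩ := Finset.mem_image.1 hc <;>
          have h1 := hθ _ hkmem i (hup i hi)
        · exact Real.cos_pos_of_mem_Ioo ⟨by linarith [h1.1, Real.pi_pos], h i hi⟩
        · exact Real.cos_neg_of_pi_div_two_lt_of_lt (h i hi) (by linarith [h1.2, Real.pi_pos])
      have hZ1 : ∀ c ∈ Z, c ^ 2 < 1 := by
        intro c hc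
        obtain ⟨i, hi, rfl⟩ := Finset.mem_image.1 hc
        have h1 := hθ _ hkmem i (hup i hi)
        have := Real.sin_pos_of_mem_Ioo h1
        nlinarith [Real.sin_sq_add_cos_sq (θ i (k + 1))]
      have hN : n + 1 - 2 * ∑ i ∈ Finset.Icc 1 k, lam i = s + Z.card := by omega
      have hzero : ∀ i ∈ Finset.Icc 1 (2 * l), ∀ φ ∈ Theta (if i ≤ l then 0 else 1) s,
          harmonicSum S a b (θ i (k + 1)) φ = 0 := by
        intro i hi φ hφ
        have h1 := hT (θ i (k + 1)) φ
        rw [hTX _ ⟨k + 1, hkmem, i, hi, φ, hφ, rfl⟩, Complex.ofReal_zero] at h1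
        exact (mul_eq_zero.1 h1.symm).resolve_left
          (Complex.ofReal_ne_zero.2 (hW _ hkmem (by omega) i hi))
      obtain ⟨a', b', ha', hb', hfac⟩ := exists_harmonicSum_factor (s := s) (S := S) Z (by omega)
        (by omega) hside hZ1 (fun m hm => hmemS m (by omega)) (hN ▸ ha) (hN ▸ hb)
        (fun c hc φ hφ => by
          obtain ⟨i, hi, rfl⟩ := Finset.mem_image.1 hc
          have h1 := hIcc _ hkmem i (hup i hi)
          rw [Real.arccos_cos h1.1 h1.2]
          exact hzero i (hup i hi) φ (by rwa [if_pos (Finset.mem_Icc.1 hi).2]))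
        (fun c hc φ hφ => by
          obtain ⟨i, hi, rfl⟩ := Finset.mem_image.1 hc
          have h1 := hIcc _ hkmem _ (hrefl i hi)
          rw [hnegcos i hi, Real.arccos_cos h1.1 h1.2]
          -- The index `2l + 1 - i` exceeds `l`, so this latitude carries the rotated grid.
          refine hzero _ (hrefl i hi) φ ?_
          have := (Finset.mem_Icc.1 hi).2
          rwa [if_neg (by omega)])
      have hN' : n + 1 - 2 * ∑ i ∈ Finset.Icc 1 (k + 1), lam i = s - Z.card := by
        rw [Finset.sum_Icc_succ_top (by omega)]
        omega
      refine ⟨a', b', W * Lagrange.nodal (symmetrize Z) id, hN' ▸ ha', hN' ▸ hb', ?_, ?_⟩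
      · intro k' hk' hlt i hi
        rw [Polynomial.eval_mul]
        refine mul_ne_zero (hW k' hk' (by omega) i hi) ?_
        refine Lagrange.eval_nodal_not_at_node fun c hc heq => ?_
        -- The roots of the new factor are the cosines of this group's `2l` latitudes, and the
        -- cosine is injective on `[0, π]`.
        have hne : ∀ j ∈ Finset.Icc 1 (2 * l),
            Real.cos (θ i k') ≠ Real.cos (θ j (k + 1)) := fun j hj h => by
          have := (hdist k' hk' i hi _ hkmem j hj
            (Real.injOn_cos (hIcc _ hk' i hi) (hIcc _ hkmem j hj) h)).2
          omega
        rcases Finset.mem_union.1 hc with hc | hc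
        · obtain ⟨j, hj, rfl⟩ := Finset.mem_image.1 hc
          exact hne j (hup j hj) heq
        · obtain ⟨d, hd, rfl⟩ := Finset.mem_image.1 hc
          obtain ⟨j, hj, rfl⟩ := Finset.mem_image.1 hd
          exact hne _ (hrefl j hj) (heq.trans (hnegcos j hj))
      · intro t φ
        rw [hT, hfac, Polynomial.eval_mul, Complex.ofReal_mul, mul_assoc]
  obtain ⟨a, b, W, ha, hb, -, h⟩ := key σ le_rfl
  rw [hsum2, Nat.sub_self] at ha hb
  funext x
  obtain ⟨t, φ, rfl⟩ := exists_sphericalPoint x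
  have h1 := h t φ
  have h2 : harmonicSum S a b t φ = 0 :=
    Finset.sum_eq_zero fun m _ => by simp [ha.eq_zero (Nat.zero_le _), hb.eq_zero (Nat.zero_le _)]
  rw [h2, mul_zero] at h1
  exact_mod_cast h1
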